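/- **Model.** Fix a visibility radius $V>0$. Robots are points of $\mathbb R^2$. Each robot has its own local coordinate system, centred at its current position, with its own orientation and handedness (constant in time); the unit of length is common. A *team* $R$ of $n$ robots is specified by the nonempty set of assignments of local coordinate systems that may occur (all of them, those with common handedness, one common system, etc.). The robots are anonymous and execute the same deterministic protocol. In the model $\mathcal{FCOM}$ every robot carries a light with finitely many colours, initially off. In each round every activated robot takes a snapshot, which is the set of pairs (position, colour) of the other robots it sees, in its local coordinates; from this snapshot alone (not the colour of its own light, and no memory) it computes a destination and a new colour for its light, and it moves to that destination along a straight segment. Under full visibility ($F.V.$) it sees all robots; under limited visibility ($L.V.$) it sees exactly those at distance at most $V$. Under $FSYNCH$ ($F$) all robots are activated in every round; under $SSYNCH$ ($S$) an adversary chooses a nonempty set of robots in each round, every robot being activated infinitely often. A *problem* for $n$ robots is a set of initial placements of $n$ robots, each with a connected visibility graph (two robots are adjacent if their distance is at most $V$), together with the set of sequences of placements, one per round, that count as solutions. $\mathcal{FCOM}^X_W(R)$ is the set of problems for which there are a finite number of colours and a protocol that produces a solution for every coordinate assignment of $R$, every initial placement and every activation sequence allowed by $X$. Write $\mathcal M_1>\mathcal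 M_2$ if $\mathcal M_1(R)\supseteq \mathcal M_2(R)$ for all teams $R$ and $\mathcal M_1(R)\setminus\mathcal M_2(R)\ne\emptyset$ for some team $R$. **Angle Equalization (AE).** Robots $r_1,r_2,r_3,r_4$ are at $A,B,C,D$. Let $E$ lie on line $CB$ beyond $B$ and $F$ on line $BC$ beyond $C$. Initially (Configuration (I)) $0<\theta_1=\angle ABE<\theta_2=\angle DCF<90^\circ$, the visibility graph is connected, and the four-point set determines the roles (no other assignment of the four points to $A,B,C,D$ satisfies these inequalities). The robots must, in finitely many rounds, reach a placement with $\angle ABE=\angle DCF=\theta_2$ (Configuration (II)) and rest there, while $r_2,r_3$ never move, no collision occurs (the segments travelled by two different robots in the same round are always disjoint), and in every round $\angle ABE$ and $\angle DCF$ are less than $90^\circ$ for the current positions. **Theorem.** For every $V>0$, $$\mathcal{FCOM}^F_{F.V.}>\mathcal{FCOM}^F_{L.V.}\qquad\text{and}\qquad \mathcal{FCOM}^S_{F.V.}>\mathcal{FCOM}^S_{L.V.},$$ with witness AE: for each $X\in\{F,S\}$ and every team $R$ of four robots, $AE\in\mathcal{FCOM}^X_{F.V.}(R)\setminus\mathcal{FCOM}^X_{L.V.}(R)$.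 -/

import Mathlib

noncomputable section

namespace Robots

/-- The Euclidean plane. -/
abbrev Plane : Type := EuclideanSpace ℝ (Fin 2)

/-- Placement of `n` robots in the plane. -/
abbrev Placement (n : ℕ) : Type := Fin n → Plane

/-- Orientation and handedness of a local coordinate system. The robot is always at the origin of
its own system; the unit of length is the common one. -/
abbrev Frame : Type := Plane ≃ₗᵢ[ℝ] Plane

/-- A team of `n` robots, given by what it agrees on: the assignments of local coordinate systems
that may occur (all of them, those with a common handedness, a single common one, ...). -/
structure Team (n : ℕ) where
  frames : Set (Fin n → Frame)
  nonempty : frames.Nonempty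

inductive Scheduler
  | FSYNCH
  | SSYNCH

inductive Visibility
  | full
  | limited

/-- `W.Sees V x y`: a robot at `x` observes a robot at `y`, where `V` is the visibility radius. -/
def Visibility.Sees (V : ℝ) (W : Visibility) (x y : Plane) : Prop :=
  match W with
  | .full => True
  | .limited => dist x y ≤ V

/-- The visibility graph of a placement. -/
def visibilityGraph (V : ℝ) {n : ℕ} (p : Placement n) : SimpleGraph (Fin n) where
  Adj i j := i ≠ j ∧ dist (p i) (p j) ≤ V
  symm := ⟨fun _ _ h => ⟨h.1.symm, by rw [dist_comm]; exact h.2⟩⟩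
  loopless := ⟨fun _ h => h.1 rfl⟩

/-- The sets of robots activated in the successive rounds, as the scheduler may choose them. -/
def Scheduler.Allows (S : Scheduler) {n : ℕ} (act : ℕ → Finset (Fin n)) : Prop :=
  match S with
  | .FSYNCH => ∀ t, act t = Finset.univ
  | .SSYNCH => (∀ t, (act t).Nonempty) ∧ ∀ i t, ∃ t', t ≤ t' ∧ i ∈ act t'

/-- Positions and light colours of `n` robots; there are `k + 1` colours, and `0` is "off". -/
structure Config (n k : ℕ) where
  pos : Placement n
  light : Fin n → Fin (k + 1)

/-- A snapshot is a set of pairs (position, colour), in local coordinates. -/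
abbrev Snapshot (k : ℕ) : Type := Set (Plane × Fin (k + 1))

/-- A protocol, common to all robots: from a snapshot it computes the destination, in local
coordinates, and the new colour of the robot's own light. It has no other input. -/
abbrev Protocol (k : ℕ) : Type := Snapshot k → Plane × Fin (k + 1)

/-- What robot `i` sees in the model `FCOM`: positions and colours of the visible other robots,
in its own coordinate system, but not the colour of its own light. -/
def look (V : ℝ) (W : Visibility) {n k : ℕ} (fr : Fin n → Frame) (c : Config n k) (i : Fin n) :
    Snapshot k :=
  {x | ∃ j, j ≠ i ∧ W.Sees V (c.pos i) (c.pos j) ∧ x = (fr i (c.pos j - c.pos i), c.light j)}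

/-- One round: the robots in `act` perform a Look-Compute-Move cycle, the others do nothing. -/
def step (V : ℝ) (W : Visibility) {n k : ℕ} (fr : Fin n → Frame) (A : Protocol k)
    (act : Finset (Fin n)) (c : Config n k) : Config n k where
  pos i := if i ∈ act then c.pos i + (fr i).symm (A (look V W fr c i)).1 else c.pos i
  light i := if i ∈ act then (A (look V W fr c i)).2 else c.light i

/-- The execution of a protocol, started with all lights off. -/
def run (V : ℝ) (W : Visibility) {n k : ℕ} (fr : Fin n → Frame) (A : Protocol k)
    (act : ℕ → Finset (Fin n)) (p : Placement n) : ℕ → Config n k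
  | 0 => ⟨p, fun _ => 0⟩
  | t + 1 => step V W fr A (act t) (run V W fr A act p t)

/-- A problem for `n` robots: the initial placements, all with a connected visibility graph, and
the sequences of placements (one for each round) that are solutions. -/
structure Problem (V : ℝ) (n : ℕ) where
  init : Set (Placement n)
  connected : ∀ p ∈ init, (visibilityGraph V p).Connected
  spec : Set (ℕ → Placement n)

/-- `FCOM V S W R` is the set of problems that the team `R` solves with finitely many light
colours in the model `FCOM`, under the adversarial scheduler `S` and with visibility `W`, where the
radius of limited visibility is `V`. -/
def FCOM (V : ℝ) (S : Scheduler) (W : Visibility) {n : ℕ} (R : Team n) : Set (Problem V n) :=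
  {P | ∃ (k : ℕ) (A : Protocol k), ∀ fr ∈ R.frames, ∀ p ∈ P.init,
    ∀ act : ℕ → Finset (Fin n), S.Allows act → (fun t => (run V W fr A act p t).pos) ∈ P.spec}

/-- "Computationally not less powerful". -/
def NotLessPowerful {V : ℝ} (T₁ T₂ : ∀ {n : ℕ}, Team n → Set (Problem V n)) : Prop :=
  ∀ (n : ℕ) (R : Team n), T₂ R ⊆ T₁ R

/-- "Computationally more powerful". -/
def MorePowerful {V : ℝ} (T₁ T₂ : ∀ {n : ℕ}, Team n → Set (Problem V n)) : Prop :=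
  NotLessPowerful T₁ T₂ ∧ ∃ (n : ℕ) (R : Team n), (T₁ R \ T₂ R).Nonempty

/-! ### Angle equalization: the robots `0, 1, 2, 3` start in `A, B, C, D` -/

/-- The angle `∠ A B E`, where `E` lies on line `C B` beyond `B`. -/
def leftAngle (p : Placement 4) : ℝ := InnerProductGeometry.angle (p 0 - p 1) (p 1 - p 2)

/-- The angle `∠ D C F`, where `F` lies on line `B C` beyond `C`. -/
def rightAngle (p : Placement 4) : ℝ := InnerProductGeometry.angle (p 3 - p 2) (p 2 - p 1)

/-- The initial shape. As angles with the zero vector are `π / 2` in Mathlib, the four points are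
automatically distinct. -/
def ConfigI (p : Placement 4) : Prop :=
  0 < leftAngle p ∧ leftAngle p < rightAngle p ∧ rightAngle p < Real.pi / 2

/-- The final shape, for the prescribed angle `θ`. -/
def ConfigII (θ : ℝ) (p : Placement 4) : Prop := leftAngle p = θ ∧ rightAngle p = θ

/-- No two robots can meet: the straight paths covered in a round by two robots are disjoint. -/
def CollisionFree {n : ℕ} (q : ℕ → Placement n) : Prop :=
  ∀ t i j, i ≠ j → Disjoint (segment ℝ (q t i) (q (t + 1) i)) (segment ℝ (q t j) (q (t + 1) j))

/-- The problem of angle equalization. The roles of the robots have to be determined by the set of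
the four points. The end robots keep making acute angles with line `E B C F`. -/
def AE (V : ℝ) : Problem V 4 where
  init := {p | ConfigI p ∧ (∀ σ : Equiv.Perm (Fin 4), ConfigI (p ∘ σ) → σ = 1) ∧
    (visibilityGraph V p).Connected}
  connected _ h := h.2.2
  spec := {q | CollisionFree q ∧ (∀ t, q t 1 = q 0 1 ∧ q t 2 = q 0 2) ∧
    (∀ t, leftAngle (q t) < Real.pi / 2 ∧ rightAngle (q t) < Real.pi / 2) ∧
    ∃ T, ConfigII (rightAngle (q 0)) (q T) ∧ ∀ t, T ≤ t → q t = q T}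

end Robots

end

/-! Full visibility is at least as strong: snapshots are local and isometric, so a robot can discard
everything beyond distance `V` and simulate any limited-visibility protocol.

With full visibility, AE is solved by having each robot display its role (four colours besides
"off"). Robot `0` moves only when it sees the other three roles lit, and lights itself in the same
round. So while some light is off the placement is still the initial one, which determines the
roles; afterwards a robot reads its role as the colour missing from its snapshot (`Invariant`,
`Invariant.role_look`).

With limited visibility, place the fixed robots `1`, `2` at distance exactly `V`. The acute angles
then keep all non-neighbours out of sight (`far_of_acute`), so robots `0` and `1` learn about robot
`3` only through the light of robot `2`. Up to the round when the goal is reached, that light shows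
a finite word over a finite alphabet. There are countably many such words but uncountably many
values of the right angle, so two different angles would lead to the same final left angle. -/

noncomputable section

namespace Robots

/-! ### Simulating limited visibility under full visibility -/

section Visibility

variable {V : ℝ} {n k : ℕ}

/-- The protocol that ignores all robots at distance greater than `V`. -/
def Protocol.restrict (V : ℝ) (A : Protocol k) : Protocol k :=
  fun s => A {x ∈ s | ‖x.1‖ ≤ V}

theorem look_limited_eq (fr : Fin n → Frame) (c : Config n k) (i : Fin n) :
    look V .limited fr c i = {x ∈ look V .full fr c i | ‖x.1‖ ≤ V} := by
  ext x
  constructor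
  · rintro ⟨j, hj, hs, rfl⟩
    refine ⟨⟨j, hj, trivial, rfl⟩, ?_⟩
    rw [LinearIsometryEquiv.norm_map, ← dist_eq_norm, dist_comm]
    exact hs
  · rintro ⟨⟨j, hj, -, rfl⟩, hs⟩
    refine ⟨j, hj, ?_, rfl⟩
    rw [LinearIsometryEquiv.norm_map, ← dist_eq_norm, dist_comm] at hs
    exact hs

theorem run_full_restrict (fr : Fin n → Frame) (A : Protocol k) (act : ℕ → Finset (Fin n))
    (p : Placement n) (t : ℕ) :
    run V .full fr (A.restrict V) act p t = run V .limited fr A act p t := by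
  induction t with
  | zero => rfl
  | succ t ih => simp only [run, ih, step, look_limited_eq, Protocol.restrict]

theorem FCOM_limited_subset_full (S : Scheduler) (R : Team n) :
    FCOM V S .limited R ⊆ FCOM V S .full R := by
  rintro P ⟨k, A, hA⟩
  refine ⟨k, A.restrict V, fun fr hfr p hp act hact => ?_⟩
  simp only [run_full_restrict]
  exact hA fr hfr p hp act hact

end Visibility

theorem Scheduler.Allows.exists_mem {S : Scheduler} {n : ℕ} {act : ℕ → Finset (Fin n)}
    (h : S.Allows act) (i : Fin n) (t : ℕ) : ∃ t', t ≤ t' ∧ i ∈ act t' := by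
  cases S with
  | FSYNCH => exact ⟨t, le_rfl, by rw [h t]; exact Finset.mem_univ i⟩
  | SSYNCH => exact h.2 i t

theorem Scheduler.allows_univ (S : Scheduler) {n : ℕ} [NeZero n] :
    S.Allows (fun _ => (Finset.univ : Finset (Fin n))) := by
  cases S with
  | FSYNCH => exact fun _ => rfl
  | SSYNCH => exact ⟨fun _ => Finset.univ_nonempty, fun i t => ⟨t, le_rfl, Finset.mem_univ i⟩⟩

/-! ### Geometry of the four points -/

theorem angle_lt_pi_div_two_iff {x y : Plane} :
    InnerProductGeometry.angle x y < Real.pi / 2 ↔ 0 < inner ℝ x y := by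
  rw [InnerProductGeometry.angle, Real.arccos_lt_pi_div_two]
  refine ⟨fun h => ?_, fun h => ?_⟩
  · by_contra! hn
    exact absurd h (div_nonpos_of_nonpos_of_nonneg hn (by positivity)).not_gt
  · exact div_pos h (h.trans_le (real_inner_le_norm x y))

theorem leftAngle_lt_iff {p : Placement 4} :
    leftAngle p < Real.pi / 2 ↔ 0 < inner ℝ (p 0 - p 1) (p 1 - p 2) :=
  angle_lt_pi_div_two_iff

theorem rightAngle_lt_iff {p : Placement 4} :
    rightAngle p < Real.pi / 2 ↔ 0 < inner ℝ (p 3 - p 2) (p 2 - p 1) :=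
  angle_lt_pi_div_two_iff

theorem leftAngle_map (e : Frame) (v : Plane) (p : Placement 4) :
    leftAngle (fun j => e (p j - v)) = leftAngle p := by
  simp only [leftAngle, ← map_sub, sub_sub_sub_cancel_right]
  exact e.toLinearIsometry.angle_map _ _

theorem rightAngle_map (e : Frame) (v : Plane) (p : Placement 4) :
    rightAngle (fun j => e (p j - v)) = rightAngle p := by
  simp only [rightAngle, ← map_sub, sub_sub_sub_cancel_right]
  exact e.toLinearIsometry.angle_map _ _

theorem configI_map (e : Frame) (v : Plane) (p : Placement 4) :
    ConfigI (fun j => e (p j - v)) ↔ ConfigI p := by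
  simp only [ConfigI, leftAngle_map, rightAngle_map]

theorem ConfigI.leftAngle_lt {p : Placement 4} (h : ConfigI p) : leftAngle p < Real.pi / 2 :=
  h.2.1.trans h.2.2

/-- Two placements that differ only in the position of robot `0` have the same right angle. -/
theorem rightAngle_congr {p q : Placement 4} (h : ∀ i, i ≠ 0 → p i = q i) :
    rightAngle p = rightAngle q := by
  simp only [rightAngle, h 1 (by decide), h 2 (by decide), h 3 (by decide)]

/-- The robots lie in the order `0, 1, 2, 3` along the line from robot `1` to robot `2`. -/
theorem inner_lt_of_acute {p : Placement 4} (hl : leftAngle p < Real.pi / 2)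
    (hr : rightAngle p < Real.pi / 2) :
    inner ℝ (p 0) (p 2 - p 1) < inner ℝ (p 1) (p 2 - p 1) ∧
    inner ℝ (p 1) (p 2 - p 1) < inner ℝ (p 2) (p 2 - p 1) ∧
    inner ℝ (p 2) (p 2 - p 1) < inner ℝ (p 3) (p 2 - p 1) := by
  rw [leftAngle_lt_iff] at hl
  rw [rightAngle_lt_iff, inner_sub_left] at hr
  rw [← neg_sub (p 2) (p 1), inner_neg_right, inner_sub_left] at hl
  have h12 : 0 < inner ℝ (p 2 - p 1) (p 2 - p 1) := by
    refine lt_of_le_of_ne real_inner_self_nonneg fun h => ?_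
    rw [eq_comm, inner_self_eq_zero] at h
    simp [h] at hr
  rw [inner_sub_left] at h12
  exact ⟨by linarith, by linarith, by linarith⟩

theorem injective_of_acute {p : Placement 4} (hl : leftAngle p < Real.pi / 2)
    (hr : rightAngle p < Real.pi / 2) : Function.Injective p := by
  obtain ⟨h0, h1, h2⟩ := inner_lt_of_acute hl hr
  have hm : StrictMono fun i => inner ℝ (p i) (p 2 - p 1) := by
    rw [Fin.strictMono_iff_lt_succ]
    intro i
    fin_cases i
    · exact h0
    · exact h1
    · exact h2
  exact fun i j hij => hm.injective (by simp only [hij])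

theorem ConfigI.injective {p : Placement 4} (h : ConfigI p) : Function.Injective p :=
  injective_of_acute h.leftAngle_lt h.2.2

/-- Every nonzero vector of the plane makes every angle with some vector. -/
theorem exists_angle_eq {w : Plane} (hw : w ≠ 0) {θ : ℝ} (h0 : 0 ≤ θ) (h1 : θ ≤ Real.pi) :
    ∃ u : Plane, InnerProductGeometry.angle u w = θ := by
  have hw' : 0 < ‖w‖ := norm_pos_iff.2 hw
  have hn : ‖w‖ ^ 2 = w 0 ^ 2 + w 1 ^ 2 := by
    simp [EuclideanSpace.norm_sq_eq, Fin.sum_univ_two]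
  -- The witness is `w` rotated by `θ`.
  refine ⟨!₂[Real.cos θ * w 0 - Real.sin θ * w 1, Real.cos θ * w 1 + Real.sin θ * w 0], ?_⟩
  set u : Plane := !₂[Real.cos θ * w 0 - Real.sin θ * w 1, Real.cos θ * w 1 + Real.sin θ * w 0]
    with hu
  have hun : ‖u‖ = ‖w‖ := by
    rw [← sq_eq_sq₀ (norm_nonneg _) (norm_nonneg _), hn, EuclideanSpace.norm_sq_eq,
      Fin.sum_univ_two]
    simp only [hu, Real.norm_eq_abs, sq_abs, PiLp.toLp_apply, Matrix.cons_val_zero,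
      Matrix.cons_val_one]
    linear_combination (w 0 ^ 2 + w 1 ^ 2) * Real.sin_sq_add_cos_sq θ
  have hin : inner ℝ u w = Real.cos θ * ‖w‖ ^ 2 := by
    rw [hn, PiLp.inner_apply, Fin.sum_univ_two]
    simp [hu]
    ring
  rw [InnerProductGeometry.angle, hun, hin, pow_two, mul_div_assoc,
    div_self (mul_pos hw' hw').ne', mul_one, Real.arccos_cos h0 h1]

/-- The paths of two robots are disjoint if only robot `0` moves. -/
theorem disjoint_segment_of_acute {p q : Placement 4} (hpq : ∀ i, i ≠ 0 → q i = p i)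
    (hp : leftAngle p < Real.pi / 2) (hq : leftAngle q < Real.pi / 2)
    (hr : rightAngle p < Real.pi / 2) {i j : Fin 4} (hij : i ≠ j) :
    Disjoint (segment ℝ (p i) (q i)) (segment ℝ (p j) (q j)) := by
  -- Both ends of the path of robot `0` project strictly before robot `1` on the line from `1` to
  -- `2`, hence so does the whole path; the other robots project no earlier than `1`.
  have key : ∀ j, j ≠ 0 → p j ∉ segment ℝ (p 0) (q 0) := by
    rintro j hj ⟨a, b, ha, hb, hab, he⟩
    obtain ⟨h0, h1, h2⟩ := inner_lt_of_acute hp hr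
    have h0' := (inner_lt_of_acute hq (by rwa [rightAngle_congr hpq])).1
    rw [hpq 1 (by decide), hpq 2 (by decide)] at h0'
    have hlt : inner ℝ (p j) (p 2 - p 1) < inner ℝ (p 1) (p 2 - p 1) := by
      rw [← he, inner_add_left, real_inner_smul_left, real_inner_smul_left]
      rcases ha.eq_or_lt with rfl | ha
      · obtain rfl : b = 1 := by linarith
        linarith
      · have h1 := mul_lt_mul_of_pos_left h0 ha
        have h2 := mul_le_mul_of_nonneg_left h0'.le hb
        linear_combination h1 + h2 + inner ℝ (p 1) (p 2 - p 1) * hab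
    fin_cases j
    · exact hj rfl
    · exact lt_irrefl _ hlt
    · exact lt_asymm hlt h1
    · exact lt_asymm hlt (h1.trans h2)
  rw [Set.disjoint_left]
  by_cases hi : i = 0
  · subst hi
    rw [hpq j hij.symm, segment_same]
    rintro x hx rfl
    exact key j hij.symm hx
  · rw [hpq i hi, segment_same]
    rintro x rfl hx
    by_cases hj : j = 0
    · subst hj
      exact key i hi hx
    · rw [hpq j hj, segment_same] at hx
      exact hij (injective_of_acute hp hr hx)

/-! ### A protocol for angle equalization under full visibility -/

/-- All robots other than `i` show the colours of their roles. -/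
def LitExcept (s : Snapshot 4) (i : Fin 4) : Prop := ∀ j, j ≠ i → ∃ x, (x, j.succ) ∈ s

/-- The observer has role `i` in an initial configuration. -/
def InitialRole (s : Snapshot 4) (i : Fin 4) : Prop :=
  ∃ q : Placement 4, q i = 0 ∧ ConfigI q ∧ ∀ j, j ≠ i → ∃ a, (q j, a) ∈ s

open Classical in
/-- The role of the observer: the missing colour if the other roles are visible, and otherwise the
role in the initial configuration. -/
def role (s : Snapshot 4) : Fin 4 :=
  if ∃ i, LitExcept s i then Classical.epsilon (LitExcept s) else Classical.epsilon (InitialRole s)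

open Classical in
/-- The destination of robot `0` at the origin. -/
def target (q : Placement 4) : Plane :=
  -- Resting must be explicit: the choice below could pick another point of the same ray, or of its
  -- mirror image.
  if leftAngle q = rightAngle q then 0
  else Classical.epsilon fun d =>
    InnerProductGeometry.angle (d - q 1) (q 1 - q 2) = rightAngle q

open Classical in
/-- Everybody shows its role; robot `0` moves as soon as it sees all the other roles. -/
def equalize : Protocol 4 := fun s =>
  (if LitExcept s 0 then
      target (Classical.epsilon fun q => q 0 = 0 ∧ ∀ j, j ≠ 0 → (q j, j.succ) ∈ s)
    else 0, (role s).succ)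

theorem angle_target {q : Placement 4} (hq : q 0 = 0) (hr : rightAngle q < Real.pi / 2) :
    InnerProductGeometry.angle (target q - q 1) (q 1 - q 2) = rightAngle q := by
  unfold target
  split_ifs with h
  · rw [← h, leftAngle, hq]
  · have hw : q 1 - q 2 ≠ 0 := by
      intro h0
      rw [rightAngle_lt_iff, ← neg_sub (q 1), h0] at hr
      simp at hr
    obtain ⟨u, hu⟩ := exists_angle_eq hw
      (InnerProductGeometry.angle_nonneg (q 3 - q 2) (q 2 - q 1))
      (InnerProductGeometry.angle_le_pi (q 3 - q 2) (q 2 - q 1))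
    exact Classical.epsilon_spec (p := fun d =>
      InnerProductGeometry.angle (d - q 1) (q 1 - q 2) = rightAngle q)
      ⟨u + q 1, by rw [add_sub_cancel_right, hu, rightAngle]⟩

/-- What remains true in an execution of `equalize` from the placement `p`. -/
structure Invariant (p : Placement 4) (c : Config 4 4) : Prop where
  light : ∀ i, c.light i = 0 ∨ c.light i = i.succ
  pos : ∀ i, i ≠ 0 → c.pos i = p i
  -- Once robot `0` has moved, every light is on, so roles no longer need to be recovered from the
  -- positions.
  stage : c.pos 0 = p 0 ∨ (∀ i, c.light i = i.succ) ∧ leftAngle c.pos = rightAngle p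

section

variable {V : ℝ} {fr : Fin 4 → Frame} {p : Placement 4} {c : Config 4 4}

theorem Invariant.light_eq (h : Invariant p c) {i j : Fin 4} (hij : c.light i = j.succ) :
    i = j := by
  rcases h.light i with h0 | h0
  · exact absurd (h0.symm.trans hij).symm (Fin.succ_ne_zero j)
  · exact Fin.succ_injective _ (h0.symm.trans hij)

/-- Only robot `j` ever carries the colour `j.succ`, and no robot sees its own light; so the one
role colour that an observer can be alone in missing is its own. -/
theorem Invariant.litExcept_iff (h : Invariant p c) {i k : Fin 4} :
    LitExcept (look V .full fr c i) k ↔ k = i ∧ ∀ j, j ≠ i → c.light j = j.succ := by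
  constructor
  · intro hk
    have hki : k = i := by
      by_contra hne
      obtain ⟨x, j, hj, -, hx⟩ := hk i (Ne.symm hne)
      exact hj (h.light_eq (Prod.ext_iff.1 hx).2.symm)
    refine ⟨hki, fun j hj => ?_⟩
    obtain ⟨x, j', hj', -, hx⟩ := hk j (hki ▸ hj)
    have := (Prod.ext_iff.1 hx).2.symm
    rwa [h.light_eq this] at this
  · rintro ⟨rfl, hl⟩ j hj
    exact ⟨_, j, hj, trivial, by rw [hl j hj]⟩

/-- If some other light is still off, robot `0` has not moved, so the observer sees the initial
placement in local coordinates. Any reading of it as an initial configuration is a permutation of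
the true one, hence the identity by `hσ`. -/
theorem Invariant.role_look (h : Invariant p c) (hI : ConfigI p)
    (hσ : ∀ σ : Equiv.Perm (Fin 4), ConfigI (p ∘ σ) → σ = 1) (i : Fin 4) :
    role (look V .full fr c i) = i := by
  unfold role
  split_ifs with hl
  · exact (h.litExcept_iff.1 (Classical.epsilon_spec hl)).1
  · have hpos : ∀ j, c.pos j = p j := by
      intro j
      rcases h.stage with h0 | h0
      · by_cases hj : j = 0
        · rw [hj, h0]
        · exact h.pos j hj
      · exact absurd ⟨i, h.litExcept_iff.2 ⟨rfl, fun j _ => h0.1 j⟩⟩ hl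
    set q : Placement 4 := fun j => fr i (p j - p i) with hq
    have hqi : q i = 0 := by simp [hq]
    have hqI : ConfigI q := (configI_map _ _ _).2 hI
    have hex : ∃ k, InitialRole (look V .full fr c i) k :=
      ⟨i, q, hqi, hqI, fun j hj => ⟨c.light j, j, hj, trivial, by simp only [hq, hpos]⟩⟩
    obtain ⟨q', hq0, hqI', hs⟩ := Classical.epsilon_spec hex
    set k := Classical.epsilon (InitialRole (look V .full fr c i))
    have hmem : ∀ j, ∃ j', q' j = q j' := by
      intro j
      by_cases hj : j = k
      · exact ⟨i, by rw [hj, hq0, hqi]⟩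
      · obtain ⟨a, j', -, -, hx⟩ := hs j hj
        exact ⟨j', (Prod.ext_iff.1 hx).1.trans (by simp only [hq, hpos])⟩
    choose f hf using hmem
    have hinj : Function.Injective f := fun a b hab =>
      hqI'.injective (by rw [hf, hf, hab])
    let σ : Equiv.Perm (Fin 4) := Equiv.ofBijective f (Finite.injective_iff_bijective.1 hinj)
    have hfun : q' = fun j => fr i ((p ∘ σ) j - p i) := funext hf
    have h1 : σ = 1 := hσ σ ((configI_map (fr i) (p i) _).1 (hfun ▸ hqI'))
    have hfk : f k = k := congrArg (fun τ : Equiv.Perm (Fin 4) => τ k) h1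
    exact hqI.injective (by rw [hqi, ← hq0, hf, hfk])

theorem Invariant.dest_of_not_lit (h : Invariant p c) {i : Fin 4}
    (hi : ¬(i = 0 ∧ ∀ j, j ≠ 0 → c.light j = j.succ)) :
    (equalize (look V .full fr c i)).1 = 0 := by
  refine if_neg fun hl => hi ?_
  obtain ⟨rfl, hl⟩ := h.litExcept_iff.1 hl
  exact ⟨rfl, hl⟩

/-- The colours label the visible points uniquely, so the placement chosen by `Classical.epsilon` is
the actual one. -/
theorem Invariant.dest_of_lit (h : Invariant p c) (hl : ∀ j, j ≠ 0 → c.light j = j.succ) :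
    (equalize (look V .full fr c 0)).1 = target (fun j => fr 0 (c.pos j - c.pos 0)) := by
  refine (if_pos (h.litExcept_iff.2 ⟨rfl, hl⟩)).trans (congrArg target ?_)
  have hex : ∃ q : Placement 4, q 0 = 0 ∧ ∀ j, j ≠ 0 → (q j, j.succ) ∈ look V .full fr c 0 :=
    ⟨fun j => fr 0 (c.pos j - c.pos 0), by simp, fun j hj => ⟨j, hj, trivial, by rw [hl j hj]⟩⟩
  obtain ⟨h0, hs⟩ := Classical.epsilon_spec hex
  funext j
  by_cases hj : j = 0
  · rw [hj, h0]; simp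
  · obtain ⟨j', -, -, hx⟩ := hs j hj
    rw [h.light_eq (Prod.ext_iff.1 hx).2.symm] at hx
    exact (Prod.ext_iff.1 hx).1

theorem Invariant.rightAngle_eq (h : Invariant p c) : rightAngle c.pos = rightAngle p :=
  rightAngle_congr h.pos

theorem Invariant.leftAngle_lt (h : Invariant p c) (hI : ConfigI p) :
    leftAngle c.pos < Real.pi / 2 := by
  rcases h.stage with h0 | h0
  · have : c.pos = p := by
      funext j
      by_cases hj : j = 0
      · rw [hj, h0]
      · exact h.pos j hj
    rw [this]
    exact hI.leftAngle_lt
  · rw [h0.2]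
    exact hI.2.2

variable {act : Finset (Fin 4)}

theorem Invariant.step_light (h : Invariant p c) (hI : ConfigI p)
    (hσ : ∀ σ : Equiv.Perm (Fin 4), ConfigI (p ∘ σ) → σ = 1) (i : Fin 4) :
    (step V .full fr equalize act c).light i = if i ∈ act then i.succ else c.light i := by
  simp only [step]
  congr 1
  simp only [equalize]
  rw [h.role_look hI hσ]

theorem Invariant.step_pos (h : Invariant p c) {i : Fin 4}
    (hi : ¬(i ∈ act ∧ i = 0 ∧ ∀ j, j ≠ 0 → c.light j = j.succ)) :
    (step V .full fr equalize act c).pos i = c.pos i := by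
  simp only [step]
  split_ifs with ha
  · rw [h.dest_of_not_lit fun h' => hi ⟨ha, h'⟩, map_zero, add_zero]
  · rfl

theorem Invariant.step_leftAngle (h : Invariant p c) (hI : ConfigI p) (ha : 0 ∈ act)
    (hl : ∀ j, j ≠ 0 → c.light j = j.succ) :
    leftAngle (step V .full fr equalize act c).pos = rightAngle p := by
  set q : Placement 4 := fun j => fr 0 (c.pos j - c.pos 0) with hq
  have hr : rightAngle q = rightAngle p := (rightAngle_map _ _ _).trans h.rightAngle_eq
  rw [← leftAngle_map (fr 0) (c.pos 0), ← hr,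
    ← angle_target (by simp [hq]) (hr.trans_lt hI.2.2), leftAngle]
  congr 1
  · rw [h.step_pos (i := 1) (by simp)]
    simp only [step, if_pos ha, h.dest_of_lit hl, ← hq]
    simp [q]
  · rw [h.step_pos (i := 1) (by simp), h.step_pos (i := 2) (by simp)]

theorem Invariant.step_pos_of_eq (h : Invariant p c) (he : leftAngle c.pos = rightAngle p) :
    (step V .full fr equalize act c).pos = c.pos := by
  funext i
  by_cases hi : i ∈ act ∧ i = 0 ∧ ∀ j, j ≠ 0 → c.light j = j.succ
  · obtain ⟨ha, rfl, hl⟩ := hi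
    simp only [step, if_pos ha, h.dest_of_lit hl]
    rw [target, if_pos, map_zero, add_zero]
    rw [leftAngle_map, rightAngle_map, he, h.rightAngle_eq]
  · exact h.step_pos hi

theorem Invariant.step (h : Invariant p c) (hI : ConfigI p)
    (hσ : ∀ σ : Equiv.Perm (Fin 4), ConfigI (p ∘ σ) → σ = 1) :
    Invariant p (step V .full fr equalize act c) where
  light i := by
    rw [h.step_light hI hσ]
    split_ifs
    · exact Or.inr rfl
    · exact h.light i
  pos i hi := by rw [h.step_pos fun h' => hi h'.2.1, h.pos i hi]
  stage := by
    have hlit : ∀ i, c.light i = i.succ →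
        (Robots.step V .full fr equalize act c).light i = i.succ := by
      intro i hi
      rw [h.step_light hI hσ, hi, ite_self]
    rcases h.stage with h0 | h0
    · by_cases hi : 0 ∈ act ∧ ∀ j : Fin 4, j ≠ 0 → c.light j = j.succ
      · refine Or.inr ⟨fun i => ?_, h.step_leftAngle hI hi.1 hi.2⟩
        by_cases h0 : i = 0
        · rw [h.step_light hI hσ, h0, if_pos hi.1]
        · exact hlit i (hi.2 i h0)
      · exact Or.inl ((h.step_pos fun h' => hi ⟨h'.1, h'.2.2⟩).trans h0)
    · exact Or.inr ⟨fun i => hlit i (h0.1 i), by rw [h.step_pos_of_eq h0.2, h0.2]⟩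

end

theorem invariant_run {V : ℝ} {fr : Fin 4 → Frame} {p : Placement 4} (hI : ConfigI p)
    (hσ : ∀ σ : Equiv.Perm (Fin 4), ConfigI (p ∘ σ) → σ = 1) (act : ℕ → Finset (Fin 4)) (t : ℕ) :
    Invariant p (run V .full fr equalize act p t) := by
  induction t with
  | zero => exact ⟨fun _ => Or.inl rfl, fun _ _ => rfl, Or.inl rfl⟩
  | succ t ih => exact ih.step hI hσ

theorem AE_mem_FCOM_full (V : ℝ) (S : Scheduler) (R : Team 4) : AE V ∈ FCOM V S .full R := by
  refine ⟨4, equalize, fun fr _ p ⟨hI, hσ, _⟩ act hact => ?_⟩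
  have hinv := invariant_run (V := V) (fr := fr) hI hσ act
  set r := run V .full fr equalize act p with hr
  have hleft : ∀ t, leftAngle (r t).pos < Real.pi / 2 := fun t => (hinv t).leftAngle_lt hI
  have hright : ∀ t, rightAngle (r t).pos < Real.pi / 2 := fun t =>
    (hinv t).rightAngle_eq.trans_lt hI.2.2
  refine ⟨fun t i j hij => ?_, fun t => ⟨?_, ?_⟩, fun t => ⟨hleft t, hright t⟩, ?_⟩
  · refine disjoint_segment_of_acute (fun i hi => ?_) (hleft t) (hleft (t + 1)) (hright t) hij
    rw [(hinv _).pos i hi, (hinv _).pos i hi]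
  · exact (hinv t).pos 1 (by decide)
  · exact (hinv t).pos 2 (by decide)
  · have hmono : ∀ i s t, s ≤ t → (r s).light i = i.succ → (r t).light i = i.succ := by
      intro i s t hst hs
      induction t, hst using Nat.le_induction with
      | base => exact hs
      | succ t _ ih =>
        refine ((hinv t).step_light hI hσ i).trans ?_
        rw [ih, ite_self]
    have hlit : ∀ i, ∃ t, (r t).light i = i.succ := by
      intro i
      obtain ⟨t, -, ht⟩ := hact.exists_mem i 0
      exact ⟨t + 1, ((hinv t).step_light hI hσ i).trans (if_pos ht)⟩
    choose τ hτ using hlit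
    -- From the supremum of the `τ i` on, all lights are on; the next activation of robot `0` leaves
    -- the angles equal.
    obtain ⟨t, htτ, ht⟩ := hact.exists_mem 0 (Finset.univ.sup τ)
    have heq : leftAngle (r (t + 1)).pos = rightAngle p :=
      (hinv t).step_leftAngle hI ht fun j _ =>
        hmono j _ t ((Finset.le_sup (Finset.mem_univ j)).trans htτ) (hτ j)
    refine ⟨t + 1, ⟨heq, (hinv _).rightAngle_eq⟩, fun s hs => ?_⟩
    induction s, hs using Nat.le_induction with
    | base => rfl
    | succ s _ ih =>
      refine Eq.trans ?_ ih
      exact (hinv s).step_pos_of_eq ((congrArg leftAngle ih).trans heq)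

/-! ### Under limited visibility angle equalization is impossible -/

theorem angle_eq_arctan {u w : Plane} {m s : ℝ} (hm : 0 < m) (hs : 0 ≤ s) (hin : inner ℝ u w = m)
    (hn : ‖u‖ ^ 2 * ‖w‖ ^ 2 = m ^ 2 * (1 + s ^ 2)) :
    InnerProductGeometry.angle u w = Real.arctan s := by
  have h : ‖u‖ * ‖w‖ = m * √(1 + s ^ 2) := by
    rw [← sq_eq_sq₀ (by positivity) (by positivity), mul_pow, mul_pow, hn,
      Real.sq_sqrt (by positivity)]
  rw [Real.arctan_eq_arccos hs, InnerProductGeometry.angle, hin, h, div_mul_eq_div_div,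
    div_self hm.ne', one_div]

/-! ### An uncountable family of initial placements -/

/-- Twice the abscissae of the robots in `chain`. -/
def abscissa : Fin 4 → ℤ := ![-1, 0, 2, 3]

theorem abscissa_strictMono : StrictMono abscissa :=
  Fin.strictMono_iff_lt_succ.2 (by decide)

/-- A chain of four robots with angles `arctan (1 / 10)` and `arctan t`, where the distance of the
two robots in the middle is the visibility radius. -/
def chain (V t : ℝ) : Placement 4 :=
  fun i => V • !₂[(abscissa i : ℝ) / 2, ![1 / 20, 0, 0, t / 2] i]

theorem norm_sq_plane (u : Plane) : ‖u‖ ^ 2 = u 0 ^ 2 + u 1 ^ 2 := by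
  simp [EuclideanSpace.norm_sq_eq, Fin.sum_univ_two]

theorem inner_plane (u w : Plane) : inner ℝ u w = u 0 * w 0 + u 1 * w 1 := by
  simp [PiLp.inner_apply, Fin.sum_univ_two, mul_comm]

section

variable {V t : ℝ}

theorem leftAngle_chain (hV : 0 < V) : leftAngle (chain V t) = Real.arctan (1 / 10) := by
  refine angle_eq_arctan (m := V ^ 2 / 2) (by positivity) (by norm_num) ?_ ?_
  · simp [inner_plane, chain, abscissa]
    ring
  · simp [norm_sq_plane, chain, abscissa]
    ring

theorem rightAngle_chain (hV : 0 < V) (ht : 0 ≤ t) : rightAngle (chain V t) = Real.arctan t := by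
  refine angle_eq_arctan (m := V ^ 2 / 2) (by positivity) ht ?_ ?_
  · simp [inner_plane, chain, abscissa]
    ring
  · simp [norm_sq_plane, chain, abscissa]
    ring

theorem dist_chain_one_two (hV : 0 < V) : dist (chain V t 1) (chain V t 2) = V := by
  rw [dist_eq_norm, ← sq_eq_sq₀ (norm_nonneg _) hV.le, norm_sq_plane]
  simp [chain, abscissa]

theorem configI_chain (hV : 0 < V) (ht : t ∈ Set.Ioo (1 / 10 : ℝ) (1 / 5)) :
    ConfigI (chain V t) := by
  have h0 : (0 : ℝ) ≤ t := by linarith [ht.1]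
  rw [ConfigI, leftAngle_chain hV, rightAngle_chain hV h0]
  exact ⟨Real.arctan_pos.2 (by norm_num), Real.arctan_strictMono ht.1, Real.arctan_lt_pi_div_two t⟩

/-- The chain is flat: in units of `V`, ordinates contribute at most `1 / 100` to the inner product,
while a negative product of the doubled, integral abscissae contributes at most `-1 / 4`. -/
theorem abscissa_of_inner_pos (hV : 0 < V) (ht : t ∈ Set.Ioo (1 / 10 : ℝ) (1 / 5)) {i j k : Fin 4}
    (hij : i ≠ j) (hjk : j ≠ k)
    (h : 0 < inner ℝ (chain V t i - chain V t j) (chain V t j - chain V t k)) :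
    0 < (abscissa i - abscissa j) * (abscissa j - abscissa k) := by
  by_contra! hn
  have hne : (abscissa i - abscissa j) * (abscissa j - abscissa k) ≠ 0 :=
    mul_ne_zero (sub_ne_zero.2 (abscissa_strictMono.injective.ne hij)) (sub_ne_zero.2 (abscissa_strictMono.injective.ne hjk))
  have hle : (abscissa i - abscissa j) * (abscissa j - abscissa k) ≤ -1 := by omega
  have hle' : ((abscissa i : ℝ) - abscissa j) * (abscissa j - abscissa k) ≤ -1 := by
    exact_mod_cast hle
  set y : Fin 4 → ℝ := ![1 / 20, 0, 0, t / 2] with hy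
  have hy0 : ∀ i, 0 ≤ y i ∧ y i ≤ 1 / 10 := by
    intro i
    have h1 := ht.1
    have h2 := ht.2
    constructor <;> fin_cases i <;> simp [y] <;> linarith
  have hyy : (y i - y j) * (y j - y k) ≤ 1 / 100 := by
    have h1 : |y i - y j| ≤ 1 / 10 :=
      abs_le.2 ⟨by linarith [hy0 i, hy0 j], by linarith [hy0 i, hy0 j]⟩
    have h2 : |y j - y k| ≤ 1 / 10 :=
      abs_le.2 ⟨by linarith [hy0 k, hy0 j], by linarith [hy0 k, hy0 j]⟩
    calc _ ≤ |y i - y j| * |y j - y k| := by rw [← abs_mul]; exact le_abs_self _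
      _ ≤ 1 / 10 * (1 / 10) := mul_le_mul h1 h2 (abs_nonneg _) (by norm_num)
      _ = _ := by norm_num
  have hin : inner ℝ (chain V t i - chain V t j) (chain V t j - chain V t k) = V ^ 2 *
      (((abscissa i : ℝ) - abscissa j) * (abscissa j - abscissa k) / 4 +
        (y i - y j) * (y j - y k)) := by
    simp only [inner_plane, chain, ← hy]
    simp
    ring
  rw [hin] at h
  have := pos_of_mul_pos_right h (by positivity)
  linarith

/-- Acute angles force the order along the chain up to reversal, and reversal swaps the two unequal
angles. -/
theorem perm_eq_one_of_configI_chain (hV : 0 < V) (ht : t ∈ Set.Ioo (1 / 10 : ℝ) (1 / 5))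
    (σ : Equiv.Perm (Fin 4)) (h : ConfigI (chain V t ∘ σ)) : σ = 1 := by
  have hne : ∀ {i j : Fin 4}, i ≠ j → σ i ≠ σ j := σ.injective.ne
  have hl := leftAngle_lt_iff.1 h.leftAngle_lt
  have hr := rightAngle_lt_iff.1 h.2.2
  simp only [Function.comp_apply] at hl hr
  replace hl := abscissa_of_inner_pos hV ht (hne (by decide)) (hne (by decide)) hl
  replace hr := abscissa_of_inner_pos hV ht (hne (by decide)) (hne (by decide)) hr
  have key : ∀ a b c d : Fin 4,
      0 < (abscissa a - abscissa b) * (abscissa b - abscissa c) →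
      0 < (abscissa d - abscissa c) * (abscissa c - abscissa b) →
      (a = 0 ∧ b = 1 ∧ c = 2 ∧ d = 3) ∨ (a = 3 ∧ b = 2 ∧ c = 1 ∧ d = 0) := by
    intro a b c d h1 h2
    simp only [mul_pos_iff, sub_pos, sub_neg, abscissa_strictMono.lt_iff_lt] at h1 h2
    omega
  rcases key _ _ _ _ hl hr with ⟨h0, h1, h2, h3⟩ | ⟨h0, h1, h2, h3⟩
  · ext i
    fin_cases i <;> simp [h0, h1, h2, h3]
  · have h' := h.2.1
    simp only [leftAngle, rightAngle, Function.comp_apply, h0, h1, h2, h3] at h'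
    exact absurd h' (configI_chain hV ht).2.1.not_gt

theorem connected_chain (hV : 0 < V) (ht : t ∈ Set.Ioo (1 / 10 : ℝ) (1 / 5)) :
    (visibilityGraph V (chain V t)).Connected := by
  have h01 : (visibilityGraph V (chain V t)).Adj 0 1 := by
    refine ⟨by decide, ?_⟩
    rw [dist_eq_norm, ← sq_le_sq₀ (norm_nonneg _) hV.le, norm_sq_plane]
    simp [chain, abscissa]
    nlinarith
  have h12 : (visibilityGraph V (chain V t)).Adj 1 2 :=
    ⟨by decide, (dist_chain_one_two hV).le⟩
  have h23 : (visibilityGraph V (chain V t)).Adj 2 3 := by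
    refine ⟨by decide, ?_⟩
    have h1 : t ^ 2 ≤ 1 := by nlinarith [ht.1, ht.2]
    rw [dist_eq_norm, ← sq_le_sq₀ (norm_nonneg _) hV.le, norm_sq_plane]
    simp [chain, abscissa]
    nlinarith [mul_le_mul_of_nonneg_left h1 (sq_nonneg V), sq_nonneg V]
  have hreach : ∀ i, (visibilityGraph V (chain V t)).Reachable 0 i := by
    intro i
    fin_cases i
    · exact .rfl
    · exact h01.reachable
    · exact h01.reachable.trans h12.reachable
    · exact (h01.reachable.trans h12.reachable).trans h23.reachable
  exact ⟨fun i j => (hreach i).symm.trans (hreach j)⟩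

theorem chain_mem_AE_init (hV : 0 < V) (ht : t ∈ Set.Ioo (1 / 10 : ℝ) (1 / 5)) :
    chain V t ∈ (AE V).init :=
  ⟨configI_chain hV ht, perm_eq_one_of_configI_chain hV ht, connected_chain hV ht⟩

end

/-! ### Who sees whom, and the counting argument -/

/-- The projection of `x - w` on the direction of `y - z` is longer than `y - z`. Weak inequality in
`h2` admits `w = z`. -/
theorem dist_lt_of_inner_lt {x y z w : Plane} (h1 : 0 < inner ℝ (x - y) (y - z))
    (h2 : 0 ≤ inner ℝ (z - w) (y - z)) : dist y z < dist x w := by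
  have hyz : 0 < ‖y - z‖ := by
    refine norm_pos_iff.2 fun h0 => ?_
    simp [h0] at h1
  have hsum : inner ℝ (x - w) (y - z) =
      inner ℝ (x - y) (y - z) + ‖y - z‖ ^ 2 + inner ℝ (z - w) (y - z) := by
    rw [← real_inner_self_eq_norm_sq, ← inner_add_left, ← inner_add_left]
    congr 1
    abel
  have hle := real_inner_le_norm (x - w) (y - z)
  rw [dist_eq_norm, dist_eq_norm]
  refine lt_of_mul_lt_mul_right (a := ‖y - z‖) ?_ hyz.le
  nlinarith

/-- If the distance of the robots in the middle is the visibility radius, then the only pairs of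
robots that may see each other are neighbours in the chain. -/
theorem far_of_acute {V : ℝ} {p : Placement 4} (hV : dist (p 1) (p 2) = V)
    (hl : leftAngle p < Real.pi / 2) (hr : rightAngle p < Real.pi / 2) :
    V < dist (p 0) (p 2) ∧ V < dist (p 0) (p 3) ∧ V < dist (p 1) (p 3) := by
  rw [leftAngle_lt_iff] at hl
  rw [rightAngle_lt_iff] at hr
  have hr' : 0 < inner ℝ (p 2 - p 3) (p 1 - p 2) := by
    rwa [← neg_sub (p 3), ← neg_sub (p 2) (p 1), inner_neg_neg]
  refine ⟨?_, ?_, ?_⟩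
  · rw [← hV]
    exact dist_lt_of_inner_lt hl (by simp)
  · rw [← hV]
    exact dist_lt_of_inner_lt hl hr'.le
  · rw [← hV, dist_comm (p 1) (p 2), dist_comm (p 1) (p 3)]
    exact dist_lt_of_inner_lt hr (by simp)

theorem look_limited_congr {V : ℝ} {n k : ℕ} {fr : Fin n → Frame} {c c' : Config n k} {i : Fin n}
    (hi : c.pos i = c'.pos i)
    (h : ∀ j, j ≠ i → (c.pos j = c'.pos j ∧ c.light j = c'.light j) ∨
      (V < dist (c.pos i) (c.pos j) ∧ V < dist (c'.pos i) (c'.pos j))) :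
    look V .limited fr c i = look V .limited fr c' i := by
  ext x
  refine exists_congr fun j => and_congr_right fun hj => ?_
  rcases h j hj with ⟨h1, h2⟩ | ⟨h1, h2⟩
  · rw [hi, h1, h2]
  · exact iff_of_false (fun hx => hx.1.not_gt h1) (fun hx => hx.1.not_gt h2)

theorem AE_notMem_FCOM_limited {V : ℝ} (hV : 0 < V) (S : Scheduler) (R : Team 4) :
    AE V ∉ FCOM V S .limited R := by
  rintro ⟨k, A, hA⟩
  obtain ⟨fr, hfr⟩ := R.nonempty
  let I := Set.Ioo (1 / 10 : ℝ) (1 / 5)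
  -- Activating everybody is legal for both schedulers, so one argument covers both.
  let r : I → ℕ → Config 4 k := fun t => run V .limited fr A (fun _ => Finset.univ) (chain V t)
  have hspec : ∀ t : I, (fun s => (r t s).pos) ∈ (AE V).spec := fun t =>
    hA fr hfr _ (chain_mem_AE_init hV t.2) _ S.allows_univ
  have hpos : ∀ (t : I) s, (r t s).pos 1 = chain V t 1 ∧ (r t s).pos 2 = chain V t 2 :=
    fun t => (hspec t).2.1
  have hfar : ∀ (t : I) s, V < dist ((r t s).pos 0) ((r t s).pos 2) ∧
      V < dist ((r t s).pos 0) ((r t s).pos 3) ∧ V < dist ((r t s).pos 1) ((r t s).pos 3) := by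
    intro t s
    refine far_of_acute ?_ ((hspec t).2.2.1 s).1 ((hspec t).2.2.1 s).2
    rw [(hpos t s).1, (hpos t s).2, dist_chain_one_two hV]
  choose T hT _ using fun t => (hspec t).2.2.2
  -- All that the left half can learn before round `T t`: a finite word, from a countable type.
  let history : I → Σ n : ℕ, Fin n → Fin (k + 1) := fun t => ⟨T t, fun s => (r t s).light 2⟩
  have hinj : Function.Injective history := by
    intro t t' htt
    obtain ⟨hTT, hlight⟩ : T t = T t' ∧ ∀ s, s < T t → (r t s).light 2 = (r t' s).light 2 := by
      have h1 : T t = T t' := congrArg Sigma.fst htt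
      refine ⟨h1, fun s hs => ?_⟩
      have h2 := congrArg (fun x : Σ n : ℕ, Fin n → Fin (k + 1) =>
        -- The default `0` is never used; it avoids a cast between words of propositionally equal
        -- length.
        if h : s < x.1 then x.2 ⟨s, h⟩ else 0) htt
      simpa [history, hs, h1 ▸ hs] using h2
    have hpos1 : ∀ s, (r t s).pos 1 = (r t' s).pos 1 := fun s =>
      (hpos t s).1.trans (hpos t' s).1.symm
    have hpos2 : ∀ s, (r t s).pos 2 = (r t' s).pos 2 := fun s =>
      (hpos t s).2.trans (hpos t' s).2.symm
    -- Round `s + 1` depends on the light of robot `2` at `s` only, so a word of length `T t`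
    -- reaches time `T t` itself.
    have key : ∀ s, s ≤ T t → (r t s).pos 0 = (r t' s).pos 0 ∧
        (r t s).light 1 = (r t' s).light 1 ∧ (r t s).light 0 = (r t' s).light 0 := by
      intro s
      induction s with
      | zero => exact fun _ => ⟨rfl, rfl, rfl⟩
      | succ s ih =>
        intro hs
        obtain ⟨h0, h1, h2⟩ := ih (Nat.le_of_succ_le hs)
        have hlook0 : look V .limited fr (r t s) 0 = look V .limited fr (r t' s) 0 := by
          refine look_limited_congr h0 fun j hj => ?_
          fin_cases j
          · exact absurd rfl hj
          · exact Or.inl ⟨hpos1 s, h1⟩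
          · exact Or.inr ⟨(hfar t s).1, (hfar t' s).1⟩
          · exact Or.inr ⟨(hfar t s).2.1, (hfar t' s).2.1⟩
        have hlook1 : look V .limited fr (r t s) 1 = look V .limited fr (r t' s) 1 := by
          refine look_limited_congr (hpos1 s) fun j hj => ?_
          fin_cases j
          · exact Or.inl ⟨h0, h2⟩
          · exact absurd rfl hj
          · exact Or.inl ⟨hpos2 s, hlight s hs⟩
          · exact Or.inr ⟨(hfar t s).2.2, (hfar t' s).2.2⟩
        change (step V .limited fr A Finset.univ (r t s)).pos 0 =
            (step V .limited fr A Finset.univ (r t' s)).pos 0 ∧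
          (step V .limited fr A Finset.univ (r t s)).light 1 =
            (step V .limited fr A Finset.univ (r t' s)).light 1 ∧
          (step V .limited fr A Finset.univ (r t s)).light 0 =
            (step V .limited fr A Finset.univ (r t' s)).light 0
        simp only [step, Finset.mem_univ, if_true, hlook0, hlook1, h0, and_self]
    have hfin : leftAngle (r t (T t)).pos = leftAngle (r t' (T t')).pos := by
      simp only [leftAngle, ← hTT, (key _ le_rfl).1, hpos1, hpos2]
    have h1 : Real.arctan t = Real.arctan t' := by
      rw [← rightAngle_chain hV (by linarith [t.2.1]), ← rightAngle_chain hV (by linarith [t'.2.1])]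
      exact (hT t).1.symm.trans (hfin.trans (hT t').1)
    exact Subtype.ext (Real.arctan_injective h1)
  have hcount : I.Countable := hinj.countable
  rw [Cardinal.Real.Ioo_countable_iff] at hcount
  norm_num at hcount

end Robots

end

theorem mainTheorem11 (V : ℝ) (hV : 0 < V) (S : Robots.Scheduler) :
    Robots.MorePowerful (V := V)
      (fun {_} R => Robots.FCOM V S Robots.Visibility.full R)
      (fun {_} R => Robots.FCOM V S Robots.Visibility.limited R) ∧
    ∀ R : Robots.Team 4,
      Robots.AE V ∈ Robots.FCOM V S Robots.Visibility.full R \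
        Robots.FCOM V S Robots.Visibility.limited R := by
  have hAE : ∀ R : Robots.Team 4, Robots.AE V ∈ Robots.FCOM V S Robots.Visibility.full R \
      Robots.FCOM V S Robots.Visibility.limited R := fun R =>
    ⟨Robots.AE_mem_FCOM_full V S R, Robots.AE_notMem_FCOM_limited hV S R⟩
  exact ⟨⟨fun n R => Robots.FCOM_limited_subset_full S R, 4, ⟨Set.univ, Set.univ_nonempty⟩, _,
    hAE _⟩, hAE⟩
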